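/- **Model.** Let $t^\star\in[0,1]$ and $\delta_1,\delta_2>-1$. For every $n$ let $G(2),\dots,G(n)$ be a random graph sequence evolving according to $\mathrm{PA}(t^\star;\delta_1,\delta_2)$: $G(2)$ has the nodes $1,2$ joined by two parallel edges, and for $3\le k\le n$ the graph $G(k)$ arises from $G(k-1)$ by adding the node $k$ and one edge $\{k,v_k\}$ with $v_k\in\{1,\dots,k-1\}$, where, with $D_w(k-1)$ the degree of $w$ in $G(k-1)$ and $\mathcal F_{k-1}$ the $\sigma$-algebra generated by $G(k-1)$, $$\mathbb P\left(v_k=w\mid\mathcal F_{k-1}\right)=\frac{D_w(k-1)+\delta}{(2+\delta)(k-1)},\qquad 1\le w\le k-1,$$ with $\delta=\delta_1$ if $k\le\lfloor nt^\star\rfloor$ and $\delta=\delta_2$ if $k>\lfloor nt^\star\rfloor$. **Estimator.** Let $\Theta\subseteq(-1,\infty)$ be a parameter set that contains $\delta_2$ in its interior (for example $\Theta=[\eta,K]$ with $-1<\eta<\delta_2<K<\infty$, or $\Theta=(-1,\infty)$). For $0\le s<t\le1$ the score, i.e. the derivative of the log-likelihood of the steps $\lfloor ns\rfloor+1,\dots,\lfloor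 nt\rfloor$, is $$u_{(ns,nt]}(\lambda)=\sum_{\substack{\lfloor ns\rfloor<k\le\lfloor nt\rfloor\\ k\ge3}}\left(\frac1{D_{v_k}(k-1)+\lambda}-\frac1{2+\lambda}\right),$$ and the maximum likelihood estimator $\hat\delta_{(ns,nt]}$ is a solution $\lambda\in\Theta$ of $u_{(ns,nt]}(\lambda)=0$ (set to $0$ if there is none). **Theorem.** Fix $s\in[t^\star,1]$ and $\tau\in(0,1-s)$. Then, as $n\to\infty$, with probability tending to $1$ the equation $u_{(ns,nt]}(\lambda)=0$ has exactly one solution $\lambda\in\Theta$ for all $t\in[s+\tau,1]$ simultaneously, and $$\sup_{t\in[s+\tau,1]}\left|\hat\delta_{(ns,nt]}-\delta_2\right|\xrightarrow{\ p\ }0 .$$ -/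

import Mathlib

open MeasureTheory Filter Topology Set

noncomputable section

/-- The edges of the graph `G(k)`, `k ≥ 2`, on the nodes `1, …, k`: two parallel edges between
`1` and `2`, and for every `j = 3, …, k` one edge between the new node `j` and the older node `v j`
that it attaches to. -/
def paEdges (v : ℕ → ℕ) (k : ℕ) : Multiset (Sym2 ℕ) :=
  {s(1, 2), s(1, 2)} + (Finset.Icc 3 k).val.map fun j => s(j, v j)

/-- The degree `D_w(k)` of the node `w` in `G(k)` (the model has no self-loops). -/
def paDegree (v : ℕ → ℕ) (w k : ℕ) : ℕ :=
  (paEdges v k).countP fun e => w ∈ e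

/-- The σ-algebra `ℱ_k` generated by `G(k)`, that is, by the attachments of the nodes
`3, …, k`. -/
@[reducible] def paHistory {Ω : Type*} (v : ℕ → Ω → ℕ) (k : ℕ) : MeasurableSpace Ω :=
  ⨆ j ∈ Finset.Icc 3 k, MeasurableSpace.comap (v j) ⊤

/-- The parameter that governs the step from `G(k-1)` to `G(k)` in `PA(t⋆; δ₁, δ₂)` with `n`
nodes. -/
def paParam (n : ℕ) (tstar δ₁ δ₂ : ℝ) (k : ℕ) : ℝ :=
  if k ≤ ⌊(n : ℝ) * tstar⌋₊ then δ₁ else δ₂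

/-- Under the probability measure `P`, the graph sequence `G(2), …, G(n)` with random attachments
`v 3, …, v n` evolves according to `PA(t⋆; δ₁, δ₂)`. -/
structure IsPAChangepoint {Ω : Type*} [MeasurableSpace Ω] (P : Measure Ω) (n : ℕ)
    (tstar δ₁ δ₂ : ℝ) (v : ℕ → Ω → ℕ) : Prop where
  measurable : ∀ k ∈ Finset.Icc 3 n, Measurable (v k)
  mem_vertices : ∀ k ∈ Finset.Icc 3 n, ∀ ω, v k ω ∈ Finset.Icc 1 (k - 1)
  transition : ∀ k ∈ Finset.Icc 3 n, ∀ w ∈ Finset.Icc 1 (k - 1),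
    P[{ω | v k ω = w}.indicator (fun _ => (1 : ℝ)) | paHistory v (k - 1)] =ᵐ[P] fun ω =>
      ((paDegree (fun j => v j ω) w (k - 1) : ℝ) + paParam n tstar δ₁ δ₂ k) /
        ((2 + paParam n tstar δ₁ δ₂ k) * ((k : ℝ) - 1))

/-- The likelihood of the parameter value `x` based on the steps `a + 1, …, b`; the factors with
index below `3` are `1`. -/
def paLikelihood (v : ℕ → ℕ) (a b : ℕ) (x : ℝ) : ℝ :=
  ∏ k ∈ Finset.Ioc a b with 3 ≤ k,
    ((paDegree v (v k) (k - 1) : ℝ) + x) / ((2 + x) * ((k : ℝ) - 1))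

/-- The score, that is, the derivative in `x` of the log-likelihood based on the steps
`a + 1, …, b` (see `hasDerivAt_log_paLikelihood`). -/
def paScore (v : ℕ → ℕ) (a b : ℕ) (x : ℝ) : ℝ :=
  ∑ k ∈ Finset.Ioc a b with 3 ≤ k, (1 / ((paDegree v (v k) (k - 1) : ℝ) + x) - 1 / (2 + x))

open Classical in
/-- The maximum likelihood estimator based on the steps `a + 1, …, b`: the solution in the
parameter set `Θ` of the score equation (with the value `0` if there is no solution). -/
def paMLE (Θ : Set ℝ) (v : ℕ → ℕ) (a b : ℕ) : ℝ :=
  if h : ∃ x ∈ Θ, paScore v a b x = 0 then h.choose else 0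

theorem paDegree_pos (v : ℕ → ℕ) {w k : ℕ} (hw : w ∈ Finset.Icc 1 k) : 0 < paDegree v w k := by
  rw [Finset.mem_Icc] at hw
  rw [paDegree, Multiset.countP_pos]
  by_cases h : w ≤ 2
  · refine ⟨s(1, 2), by simp [paEdges], ?_⟩
    rw [Sym2.mem_iff]
    omega
  · refine ⟨s(w, v w), ?_, Sym2.mem_mk_left _ _⟩
    rw [paEdges, Multiset.mem_add]
    right
    rw [Multiset.mem_map]
    refine ⟨w, ?_, rfl⟩
    rw [Finset.mem_val, Finset.mem_Icc]
    omega

theorem hasDerivAt_log_paLikelihood (v : ℕ → ℕ) (a b : ℕ)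
    (hv : ∀ k ∈ Finset.Ioc a b, 3 ≤ k → v k ∈ Finset.Icc 1 (k - 1)) {x : ℝ} (hx : -1 < x) :
    HasDerivAt (fun y => Real.log (paLikelihood v a b y)) (paScore v a b x) x := by
  have key : ∀ k ∈ (Finset.Ioc a b).filter (3 ≤ ·), ∀ y : ℝ, -1 < y →
      0 < (paDegree v (v k) (k - 1) : ℝ) + y ∧ 0 < (2 + y) ∧ 0 < (k : ℝ) - 1 := by
    intro k hk y hy
    rw [Finset.mem_filter] at hk
    have h1 : (1 : ℝ) ≤ paDegree v (v k) (k - 1) := by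
      exact_mod_cast paDegree_pos v (hv k hk.1 hk.2)
    have h2 : (3 : ℝ) ≤ k := by exact_mod_cast hk.2
    exact ⟨by linarith, by linarith, by linarith⟩
  have hsum : HasDerivAt (fun y => ∑ k ∈ Finset.Ioc a b with 3 ≤ k,
      (Real.log ((paDegree v (v k) (k - 1) : ℝ) + y) - Real.log (2 + y) - Real.log ((k : ℝ) - 1)))
      (paScore v a b x) x := by
    refine HasDerivAt.fun_sum fun k hk => ?_
    obtain ⟨h1, h2, _⟩ := key k hk x hx
    exact ((((hasDerivAt_id x).const_add _).log h1.ne').sub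
      (((hasDerivAt_id x).const_add _).log h2.ne')).sub_const _
  refine hsum.congr_of_eventuallyEq ?_
  filter_upwards [Ioi_mem_nhds hx] with y hy
  rw [paLikelihood, Real.log_prod]
  · refine Finset.sum_congr rfl fun k hk => ?_
    obtain ⟨h1, h2, h3⟩ := key k hk y hy
    rw [Real.log_div h1.ne' (mul_pos h2 h3).ne', Real.log_mul h2.ne' h3.ne']
    ring
  · intro k hk
    obtain ⟨h1, h2, h3⟩ := key k hk y hy
    exact (div_pos h1 (mul_pos h2 h3)).ne'

end

/-!
For a parameter `x > -1`, the step `k` contributes `1 / (D + x) - 1 / (2 + x)` to the score, where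
`D` is the degree of the node chosen in `G(k - 1)`. All steps after `⌊n s⌋` are governed by `δ₂`.

*Drift.* The degrees in `G(k - 1)` have mean `2`. Hence the conditional mean of a contribution,
multiplied by `δ₂ - x`, is the nonnegative gap in Jensen's inequality for the convex function
`d ↦ 1 / (d + x)` times `(δ₂ - x) ^ 2 / (2 + δ₂)`, and the leaves alone make the gap at least
proportional to their share (`paMean_score_ge`). A step destroys a leaf with conditional
probability at most `(1 + δ₂) / (2 + δ₂) < 1` and always creates one, so that, up to a martingale,
the number of leaves grows at a linear rate (`paLeaves_ge`).

*Fluctuations.* A martingale with bounded increments exceeds `η n` at a fixed time with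
exponentially small probability (`integral_exp_sum_paIncrement_le`, an Azuma bound obtained from
`exp y ≤ 1 + y + y ^ 2`), so the union bound over the `n` times controls all of them at once
(`tendsto_measure_exists_le_sum_paIncrement`). This is what gives uniformity in `t`. Consequently,
at each fixed `x ≠ δ₂`, the score has the sign of `δ₂ - x` for all `t ∈ [s + τ, 1]` with probability
tending to `1` (`tendsto_measure_exists_mul_paScore_nonpos`).

*Roots.* Applied at `x = δ₂ - ε` and `x = δ₂ + ε`, this yields a root of the score in
`[δ₂ - ε, δ₂ + ε]`. It is the only root in all of `(-1, ∞)`, because `(1 + x) (2 + x)` times the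
score is a sum of antitone functions of `x` (`paScore_root_unique`). No compactness of `Θ` and no
uniform law of large numbers in `x` is needed.
-/

/-! ### Degrees and leaves -/

theorem paEdges_congr {v v' : ℕ → ℕ} {k : ℕ} (h : ∀ j ∈ Finset.Icc 3 k, v j = v' j) :
    paEdges v k = paEdges v' k := by
  rw [paEdges, paEdges]
  congr 1
  exact Multiset.map_congr rfl fun j hj => by rw [h j hj]

theorem paDegree_congr {v v' : ℕ → ℕ} {k : ℕ} (h : ∀ j ∈ Finset.Icc 3 k, v j = v' j) (w : ℕ) :
    paDegree v w k = paDegree v' w k := by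
  rw [paDegree, paDegree, paEdges_congr h]

theorem paDegree_two (v : ℕ → ℕ) (w : ℕ) :
    paDegree v w 2 = if w = 1 ∨ w = 2 then 2 else 0 := by
  have h : (({s(1, 2), s(1, 2)} : Multiset (Sym2 ℕ))) = s(1, 2) ::ₘ s(1, 2) ::ₘ 0 := rfl
  simp only [paDegree, paEdges, h, Multiset.countP_add, Multiset.countP_cons]
  by_cases hw : w = 1 ∨ w = 2 <;> simp [hw]

theorem paDegree_succ (v : ℕ → ℕ) (w : ℕ) {k : ℕ} (hk : 2 ≤ k) :
    paDegree v w (k + 1) = paDegree v w k + if w = k + 1 ∨ w = v (k + 1) then 1 else 0 := by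
  have h : Finset.Icc 3 (k + 1) = insert (k + 1) (Finset.Icc 3 k) := by
    ext j; simp only [Finset.mem_Icc, Finset.mem_insert]; omega
  have h' : k + 1 ∉ Finset.Icc 3 k := by simp
  simp only [paDegree, paEdges, h, Finset.insert_val_of_notMem h', Multiset.map_cons,
    Multiset.countP_add, Multiset.countP_cons, Sym2.mem_iff]
  omega

theorem paDegree_eq_zero {v : ℕ → ℕ} {k w : ℕ} (hk : 2 ≤ k)
    (hv : ∀ j ∈ Finset.Icc 3 k, v j ∈ Finset.Icc 1 (j - 1)) (hw : k < w) :
    paDegree v w k = 0 := by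
  induction k, hk using Nat.le_induction with
  | base => rw [paDegree_two, if_neg]; omega
  | succ k hk ih =>
    have h1 := hv (k + 1) (Finset.mem_Icc.2 ⟨by omega, le_rfl⟩)
    rw [Finset.mem_Icc] at h1
    rw [paDegree_succ v w hk, if_neg (by omega),
      ih (fun j hj => hv j (Finset.Icc_subset_Icc_right (by omega) hj)) (by omega)]

/-- The graph `G(k)` has `k` edges, so its degrees sum to `2 k`. -/
theorem sum_paDegree {v : ℕ → ℕ} {k : ℕ} (hk : 2 ≤ k)
    (hv : ∀ j ∈ Finset.Icc 3 k, v j ∈ Finset.Icc 1 (j - 1)) :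
    ∑ w ∈ Finset.Icc 1 k, paDegree v w k = 2 * k := by
  induction k, hk using Nat.le_induction with
  | base => simp [paDegree_two, Finset.sum_Icc_succ_top]
  | succ k hk ih =>
    have h1 := hv (k + 1) (Finset.mem_Icc.2 ⟨by omega, le_rfl⟩)
    rw [Finset.mem_Icc] at h1
    have hv' : ∀ j ∈ Finset.Icc 3 k, v j ∈ Finset.Icc 1 (j - 1) :=
      fun j hj => hv j (Finset.Icc_subset_Icc_right (by omega) hj)
    have h2 : (Finset.Icc 1 (k + 1)).filter (fun w => w = k + 1 ∨ w = v (k + 1))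
        = {k + 1, v (k + 1)} := by
      ext w; simp only [Finset.mem_filter, Finset.mem_Icc, Finset.mem_insert,
        Finset.mem_singleton]; omega
    rw [Finset.sum_congr rfl fun w _ => paDegree_succ v w hk, Finset.sum_add_distrib,
      Finset.sum_Icc_succ_top (by omega), ih hv', paDegree_eq_zero hk hv' (by omega),
      Finset.sum_boole, h2, Finset.card_pair (by omega)]
    simp; ring

/-- The number of leaves, that is, of nodes of degree `1`, in `G(k)`. -/
def paLeaves (v : ℕ → ℕ) (k : ℕ) : ℕ :=
  ((Finset.Icc 1 k).filter fun w => paDegree v w k = 1).card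

theorem paLeaves_le (v : ℕ → ℕ) (k : ℕ) : paLeaves v k ≤ k := by
  simpa [paLeaves] using Finset.card_filter_le (Finset.Icc 1 k) fun w => paDegree v w k = 1

/-- The new node is a leaf, and at most the node it attaches to ceases to be one. -/
theorem paLeaves_succ_ge {v : ℕ → ℕ} {k : ℕ} (hk : 2 ≤ k)
    (hv : ∀ j ∈ Finset.Icc 3 (k + 1), v j ∈ Finset.Icc 1 (j - 1)) :
    paLeaves v k + 1 ≤
      paLeaves v (k + 1) + if paDegree v (v (k + 1)) k = 1 then 1 else 0 := by
  have h1 := hv (k + 1) (Finset.mem_Icc.2 ⟨by omega, le_rfl⟩)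
  rw [Finset.mem_Icc] at h1
  have hv' : ∀ j ∈ Finset.Icc 3 k, v j ∈ Finset.Icc 1 (j - 1) :=
    fun j hj => hv j (Finset.Icc_subset_Icc_right (by omega) hj)
  set F := (Finset.Icc 1 k).filter fun w => paDegree v w k = 1 with hF
  have hsub : insert (k + 1) (F.erase (v (k + 1))) ⊆
      (Finset.Icc 1 (k + 1)).filter fun w => paDegree v w (k + 1) = 1 := by
    intro w hw
    rw [Finset.mem_filter, paDegree_succ v w hk, Finset.mem_Icc]
    rw [Finset.mem_insert, Finset.mem_erase, hF, Finset.mem_filter, Finset.mem_Icc] at hw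
    rcases hw with rfl | ⟨hw, ⟨hw1, hw2⟩, hw3⟩
    · rw [paDegree_eq_zero hk hv' (by omega)]; simp
    · rw [if_neg (by omega), hw3]; omega
  have hnot : k + 1 ∉ F.erase (v (k + 1)) := by simp [hF]
  have hcard := Finset.card_le_card hsub
  rw [Finset.card_insert_of_notMem hnot, Finset.card_erase_eq_ite] at hcard
  have hmem : v (k + 1) ∈ F ↔ paDegree v (v (k + 1)) k = 1 := by
    rw [hF, Finset.mem_filter, Finset.mem_Icc]
    exact ⟨fun h => h.2, fun h => ⟨by omega, h⟩⟩
  simp only [hmem] at hcard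
  simp only [paLeaves, ← hF]
  split_ifs at hcard ⊢ with h
  · have : 0 < F.card := Finset.card_pos.2 ⟨_, hmem.2 h⟩
    omega
  · omega

/-! ### Conditional means of functions of the degree -/

/-- The mean of `h (D_{v_k}(k-1))` under the attachment rule with parameter `δ`, given `G(k-1)`. -/
noncomputable def paMean (δ : ℝ) (h : ℕ → ℝ) (v : ℕ → ℕ) (k : ℕ) : ℝ :=
  ∑ w ∈ Finset.Icc 1 (k - 1), ((paDegree v w (k - 1) : ℝ) + δ) / ((2 + δ) * ((k : ℝ) - 1)) *
    h (paDegree v w (k - 1))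

/-- The difference of `h (D_{v_k}(k-1))` and its conditional mean given `G(k-1)` under the
attachment rule with parameter `δ`: a martingale difference if `δ` governs the step `k`. -/
noncomputable def paIncrement (δ : ℝ) (h : ℕ → ℝ) (v : ℕ → ℕ) (k : ℕ) : ℝ :=
  h (paDegree v (v k) (k - 1)) - paMean δ h v k

section Mean

variable {δ : ℝ} {v : ℕ → ℕ} {k : ℕ}

theorem sum_paDegree_pred (hk : 3 ≤ k)
    (hv : ∀ j ∈ Finset.Icc 3 k, v j ∈ Finset.Icc 1 (j - 1)) :
    ∑ w ∈ Finset.Icc 1 (k - 1), (paDegree v w (k - 1) : ℝ) = 2 * ((k : ℝ) - 1) := by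
  have h := sum_paDegree (v := v) (k := k - 1) (by omega)
    (fun j hj => hv j (Finset.Icc_subset_Icc_right (by omega) hj))
  rw [← Nat.cast_sum, h, Nat.cast_mul, Nat.cast_sub (by omega)]
  simp

theorem paWeight_nonneg (hδ : -1 < δ) (hk : 3 ≤ k) {w : ℕ} (hw : w ∈ Finset.Icc 1 (k - 1)) :
    0 ≤ ((paDegree v w (k - 1) : ℝ) + δ) / ((2 + δ) * ((k : ℝ) - 1)) := by
  have h1 : (1 : ℝ) ≤ paDegree v w (k - 1) := by exact_mod_cast paDegree_pos v hw
  have h2 : (3 : ℝ) ≤ k := by exact_mod_cast hk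
  exact div_nonneg (by linarith) (mul_nonneg (by linarith) (by linarith))

theorem sum_paWeight (hδ : -1 < δ) (hk : 3 ≤ k)
    (hv : ∀ j ∈ Finset.Icc 3 k, v j ∈ Finset.Icc 1 (j - 1)) :
    ∑ w ∈ Finset.Icc 1 (k - 1),
      ((paDegree v w (k - 1) : ℝ) + δ) / ((2 + δ) * ((k : ℝ) - 1)) = 1 := by
  have h2 : (3 : ℝ) ≤ k := by exact_mod_cast hk
  have h3 : (2 + δ) * ((k : ℝ) - 1) ≠ 0 := (mul_pos (by linarith) (by linarith)).ne'
  rw [← Finset.sum_div, Finset.sum_add_distrib, sum_paDegree_pred hk hv, div_eq_one_iff_eq h3]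
  simp only [Finset.sum_const, Nat.card_Icc, nsmul_eq_mul]
  rw [show k - 1 + 1 - 1 = k - 1 by omega, Nat.cast_sub (by omega)]
  push_cast; ring

theorem abs_paMean_le (hδ : -1 < δ) (hk : 3 ≤ k)
    (hv : ∀ j ∈ Finset.Icc 3 k, v j ∈ Finset.Icc 1 (j - 1)) {h : ℕ → ℝ} {C : ℝ}
    (hC : ∀ d, 1 ≤ d → |h d| ≤ C) : |paMean δ h v k| ≤ C := by
  calc |paMean δ h v k|
      ≤ ∑ w ∈ Finset.Icc 1 (k - 1),
        ((paDegree v w (k - 1) : ℝ) + δ) / ((2 + δ) * ((k : ℝ) - 1)) * C := by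
        refine (Finset.abs_sum_le_sum_abs _ _).trans (Finset.sum_le_sum fun w hw => ?_)
        rw [abs_mul, abs_of_nonneg (paWeight_nonneg hδ hk hw)]
        exact mul_le_mul_of_nonneg_left (hC _ (paDegree_pos v hw)) (paWeight_nonneg hδ hk hw)
    _ = C := by rw [← Finset.sum_mul, sum_paWeight hδ hk hv, one_mul]

theorem abs_paIncrement_le (hδ : -1 < δ) (hk : 3 ≤ k)
    (hv : ∀ j ∈ Finset.Icc 3 k, v j ∈ Finset.Icc 1 (j - 1)) {h : ℕ → ℝ} {C : ℝ}
    (hC : ∀ d, 1 ≤ d → |h d| ≤ C) : |paIncrement δ h v k| ≤ 2 * C := by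
  have h1 := hC _ (paDegree_pos v (hv k (Finset.mem_Icc.2 ⟨hk, le_rfl⟩)))
  have h2 := abs_paMean_le hδ hk hv hC
  have h3 := abs_sub (h (paDegree v (v k) (k - 1))) (paMean δ h v k)
  rw [paIncrement]
  linarith

theorem paMean_neg (h : ℕ → ℝ) : paMean δ (fun d => -h d) v k = -paMean δ h v k := by
  simp [paMean]

/-- A given leaf is chosen with probability `(1 + δ) / ((2 + δ) (k - 1))`, and there are at most
`k - 1` leaves. -/
theorem paMean_leaf_le (hδ : -1 < δ) (hk : 3 ≤ k) :
    paMean δ (fun d => if d = 1 then 1 else 0) v k ≤ (1 + δ) / (2 + δ) := by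
  have h2 : (3 : ℝ) ≤ k := by exact_mod_cast hk
  have h4 : 0 < 2 + δ := by linarith
  have h5 : 0 < (k : ℝ) - 1 := by linarith
  calc paMean δ (fun d => if d = 1 then 1 else 0) v k
      ≤ ∑ w ∈ Finset.Icc 1 (k - 1), (1 + δ) / ((2 + δ) * ((k : ℝ) - 1)) := by
        refine Finset.sum_le_sum fun w _ => ?_
        beta_reduce
        split_ifs with h
        · rw [h]; simp
        · rw [mul_zero]; exact div_nonneg (by linarith) (by positivity)
    _ = (1 + δ) / (2 + δ) := by
        simp only [Finset.sum_const, Nat.card_Icc, nsmul_eq_mul]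
        rw [show k - 1 + 1 - 1 = k - 1 by omega, Nat.cast_sub (by omega)]
        push_cast; field_simp

/-- The strict form of Jensen's inequality behind the consistency: since the mean degree is `2`,
the drift of the score at `x` has the sign of `δ - x`, and its size is at least proportional to
the share of the leaves. -/
theorem paMean_score_ge (hδ : -1 < δ) {x : ℝ} (hx : -1 < x) (hk : 3 ≤ k)
    (hv : ∀ j ∈ Finset.Icc 3 k, v j ∈ Finset.Icc 1 (j - 1)) :
    (δ - x) ^ 2 / ((1 + x) * (2 + x) ^ 2 * (2 + δ)) * (paLeaves v (k - 1) / ((k : ℝ) - 1)) ≤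
      paMean δ (fun d => (δ - x) * (1 / ((d : ℝ) + x) - 1 / (2 + x))) v k := by
  have h2 : (3 : ℝ) ≤ k := by exact_mod_cast hk
  have h4 : 0 < 2 + δ := by linarith
  have h5 : 0 < (k : ℝ) - 1 := by linarith
  have h6 : 0 < 2 + x := by linarith
  have h7 : 0 < 1 + x := by linarith
  set A := ((δ - x) / (2 + x) + (δ - x) ^ 2 / (2 + x) ^ 2) / ((2 + δ) * ((k : ℝ) - 1)) with hA
  set B := (δ - x) ^ 2 / ((1 + x) * (2 + x) ^ 2 * (2 + δ)) / ((k : ℝ) - 1) with hB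
  calc (δ - x) ^ 2 / ((1 + x) * (2 + x) ^ 2 * (2 + δ)) * (paLeaves v (k - 1) / ((k : ℝ) - 1))
      = ∑ w ∈ Finset.Icc 1 (k - 1), (A * (2 - (paDegree v w (k - 1) : ℝ)) +
          B * if paDegree v w (k - 1) = 1 then 1 else 0) := by
        rw [Finset.sum_add_distrib, ← Finset.mul_sum, ← Finset.mul_sum, Finset.sum_sub_distrib,
          sum_paDegree_pred hk hv, Finset.sum_boole, hB, paLeaves]
        simp only [Finset.sum_const, Nat.card_Icc, nsmul_eq_mul]
        rw [show k - 1 + 1 - 1 = k - 1 by omega, Nat.cast_sub (by omega)]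
        push_cast; ring
    _ ≤ paMean δ (fun d => (δ - x) * (1 / ((d : ℝ) + x) - 1 / (2 + x))) v k := by
        refine Finset.sum_le_sum fun w hw => ?_
        have h1 : (1 : ℝ) ≤ paDegree v w (k - 1) := by exact_mod_cast paDegree_pos v hw
        generalize paDegree v w (k - 1) = d at h1 ⊢
        have h8 : 0 < (d : ℝ) + x := by linarith
        -- Up to a multiple of `2 - d`, which sums to `0`, this is the second-order remainder of the
        -- convex function `d ↦ 1 / (d + x)` at `d = 2`.
        have key : ((d : ℝ) + δ) / ((2 + δ) * ((k : ℝ) - 1)) *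
            ((δ - x) * (1 / ((d : ℝ) + x) - 1 / (2 + x))) =
            A * (2 - d) + (δ - x) ^ 2 * (2 - d) ^ 2 / ((d + x) * (2 + x) ^ 2 * (2 + δ)) /
              ((k : ℝ) - 1) := by
          rw [hA]; field_simp; ring
        rw [key]
        gcongr
        split_ifs with hd
        · subst hd; rw [hB]; norm_num
        · rw [mul_zero]; positivity

end Mean

/-! ### Exponential martingale bound -/

/-- A function of the attachments of the nodes `3, …, k` is `ℱ_k`-measurable: there are only
countably many values of these attachments. -/
theorem measurable_paHistory_of_congr {Ω : Type*} {v : ℕ → Ω → ℕ} {k : ℕ} {f : (ℕ → ℕ) → ℝ}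
    (hf : ∀ u u' : ℕ → ℕ, (∀ j ∈ Finset.Icc 3 k, u j = u' j) → f u = f u') :
    Measurable[paHistory v k] fun ω => f fun j => v j ω := by
  let r : Ω → (Finset.Icc 3 k → ℕ) := fun ω j => v j ω
  let e : (Finset.Icc 3 k → ℕ) → ℕ → ℕ := fun y j => if h : j ∈ Finset.Icc 3 k then y ⟨j, h⟩ else 0
  have hr : Measurable[paHistory v k] r := by
    refine @measurable_pi_lambda _ _ _ (paHistory v k) _ _ fun j => ?_
    exact (comap_measurable (v j)).mono
      (le_iSup₂ (f := fun j (_ : j ∈ Finset.Icc 3 k) => MeasurableSpace.comap (v j) ⊤)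
        (j : ℕ) j.2) le_rfl
  have he : Measurable fun y => f (e y) := measurable_of_countable _
  have : (fun ω => f fun j => v j ω) = (fun y => f (e y)) ∘ r := by
    funext ω
    exact hf _ _ fun j hj => by simp [e, r, (Finset.mem_Icc.1 hj).1, (Finset.mem_Icc.1 hj).2]
  rw [this]
  exact he.comp hr

theorem paMean_congr {δ : ℝ} {h : ℕ → ℝ} {k : ℕ} {u u' : ℕ → ℕ}
    (huu : ∀ j ∈ Finset.Icc 3 (k - 1), u j = u' j) : paMean δ h u k = paMean δ h u' k :=
  Finset.sum_congr rfl fun w _ => by rw [paDegree_congr huu]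

theorem paIncrement_congr {δ : ℝ} {h : ℕ → ℝ} {k : ℕ} (hk : 3 ≤ k) {u u' : ℕ → ℕ}
    (huu : ∀ j ∈ Finset.Icc 3 k, u j = u' j) : paIncrement δ h u k = paIncrement δ h u' k := by
  have huu' : ∀ j ∈ Finset.Icc 3 (k - 1), u j = u' j :=
    fun j hj => huu j (Finset.Icc_subset_Icc_right (by omega) hj)
  rw [paIncrement, paIncrement, paMean_congr huu', huu k (Finset.mem_Icc.2 ⟨hk, le_rfl⟩),
    paDegree_congr huu']

theorem measurable_sum_paIncrement {Ω : Type*} {v : ℕ → Ω → ℕ} {A m : ℕ} (δ : ℝ)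
    (h : ℕ → ℝ) (hA : 2 ≤ A) :
    Measurable[paHistory v m]
      fun ω => ∑ k ∈ Finset.Ioc A m, paIncrement δ h (fun j => v j ω) k := by
  refine measurable_paHistory_of_congr
    (f := fun u => ∑ k ∈ Finset.Ioc A m, paIncrement δ h u k) fun u u' huu => ?_
  refine Finset.sum_congr rfl fun k hk => ?_
  rw [Finset.mem_Ioc] at hk
  exact paIncrement_congr (by omega)
    fun j hj => huu j (Finset.Icc_subset_Icc_right (by omega) hj)

section Probability

variable {Ω : Type*} [mΩ : MeasurableSpace Ω] {P : Measure Ω} {n : ℕ} {tstar δ₁ δ₂ : ℝ}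
  {v : ℕ → Ω → ℕ}

namespace IsPAChangepoint

theorem paHistory_le (hv : IsPAChangepoint P n tstar δ₁ δ₂ v) {k : ℕ} (hk : k ≤ n) :
    paHistory v k ≤ mΩ :=
  iSup₂_le fun j hj => (hv.measurable j (Finset.Icc_subset_Icc_right hk hj)).comap_le

theorem mem_Icc (hv : IsPAChangepoint P n tstar δ₁ δ₂ v) {k : ℕ} (hk : k ≤ n) (ω : Ω) :
    ∀ j ∈ Finset.Icc 3 k, v j ω ∈ Finset.Icc 1 (j - 1) :=
  fun j hj => hv.mem_vertices j (Finset.Icc_subset_Icc_right hk hj) ω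

theorem abs_sum_paIncrement_le (hv : IsPAChangepoint P n tstar δ₁ δ₂ v) {A m : ℕ} {δ : ℝ}
    (hδ : -1 < δ) {h : ℕ → ℝ} {C : ℝ} (hC : ∀ d, 1 ≤ d → |h d| ≤ C) (hA : 2 ≤ A) (hm : m ≤ n)
    (ω : Ω) :
    |∑ k ∈ Finset.Ioc A m, paIncrement δ h (fun j => v j ω) k| ≤ (m - A : ℕ) * (2 * C) := by
  refine (Finset.abs_sum_le_sum_abs _ _).trans ?_
  rw [← Nat.card_Ioc, ← nsmul_eq_mul]
  refine Finset.sum_le_card_nsmul _ _ _ fun k hk => ?_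
  rw [Finset.mem_Ioc] at hk
  exact abs_paIncrement_le hδ (by omega) (hv.mem_Icc (by omega) ω) hC

variable [IsProbabilityMeasure P]

theorem integral_mul_indicator (hv : IsPAChangepoint P n tstar δ₁ δ₂ v) {k w : ℕ}
    (hk : k ∈ Finset.Icc 3 n) (hw : w ∈ Finset.Icc 1 (k - 1)) {g : Ω → ℝ}
    (hg : Measurable[paHistory v (k - 1)] g) {B : ℝ} (hB : ∀ ω, |g ω| ≤ B) :
    ∫ ω, g ω * {ω | v k ω = w}.indicator (fun _ => (1 : ℝ)) ω ∂P =
      ∫ ω, g ω * (((paDegree (fun j => v j ω) w (k - 1) : ℝ) + paParam n tstar δ₁ δ₂ k) /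
        ((2 + paParam n tstar δ₁ δ₂ k) * ((k : ℝ) - 1))) ∂P := by
  have hk' := Finset.mem_Icc.1 hk
  have hm := hv.paHistory_le (k := k - 1) (by omega)
  have hset : MeasurableSet {ω | v k ω = w} := hv.measurable k hk (measurableSet_singleton w)
  have hint : Integrable ({ω | v k ω = w}.indicator (fun _ => (1 : ℝ))) P :=
    (integrable_const _).indicator hset
  have h1 := condExp_stronglyMeasurable_mul_of_bound hm hg.stronglyMeasurable hint B
    (ae_of_all _ hB)
  rw [← integral_condExp (μ := P) (f := fun ω => g ω * _) hm]
  refine integral_congr_ae (h1.trans ?_)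
  filter_upwards [hv.transition k hk w hw] with ω hω
  rw [Pi.mul_apply, hω]

/-- The increments are orthogonal to the bounded functions of the past. -/
theorem integral_mul_paIncrement (hv : IsPAChangepoint P n tstar δ₁ δ₂ v) {k : ℕ}
    (hk : k ∈ Finset.Icc 3 n) (hpar : paParam n tstar δ₁ δ₂ k = δ₂) (hδ : -1 < δ₂) {h : ℕ → ℝ}
    {C : ℝ} (hC : ∀ d, 1 ≤ d → |h d| ≤ C) {g : Ω → ℝ}
    (hg : Measurable[paHistory v (k - 1)] g) {B : ℝ} (hB : ∀ ω, |g ω| ≤ B) :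
    ∫ ω, g ω * paIncrement δ₂ h (fun j => v j ω) k ∂P = 0 := by
  have hk' := Finset.mem_Icc.1 hk
  have hm := hv.paHistory_le (k := k - 1) (by omega)
  set gw : ℕ → Ω → ℝ := fun w ω => g ω * h (paDegree (fun j => v j ω) w (k - 1)) with hgw
  set q : ℕ → Ω → ℝ := fun w ω =>
    ((paDegree (fun j => v j ω) w (k - 1) : ℝ) + δ₂) / ((2 + δ₂) * ((k : ℝ) - 1)) with hq
  have hgw_meas : ∀ w, Measurable[paHistory v (k - 1)] (gw w) := fun w =>
    @Measurable.mul _ _ _ _ (paHistory v (k - 1)) g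
      (fun ω => h (paDegree (fun j => v j ω) w (k - 1))) _ hg
      (measurable_paHistory_of_congr (f := fun u => h (paDegree u w (k - 1)))
        fun u u' huu => by rw [paDegree_congr huu])
  have hq_meas : ∀ w, Measurable[paHistory v (k - 1)] (q w) := fun w =>
    measurable_paHistory_of_congr
      (f := fun u => ((paDegree u w (k - 1) : ℝ) + δ₂) / ((2 + δ₂) * ((k : ℝ) - 1)))
        fun u u' huu => by rw [paDegree_congr huu]
  have hgw_bound : ∀ w ∈ Finset.Icc 1 (k - 1), ∀ ω, |gw w ω| ≤ B * C := fun w hw ω => by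
    rw [hgw, abs_mul]
    exact mul_le_mul (hB ω) (hC _ (paDegree_pos _ hw)) (abs_nonneg _) ((abs_nonneg _).trans (hB ω))
  have hq_bound : ∀ w ∈ Finset.Icc 1 (k - 1), ∀ ω, |q w ω| ≤ 1 := fun w hw ω => by
    have h0 : ∀ w ∈ Finset.Icc 1 (k - 1), 0 ≤ q w ω :=
      fun w hw => paWeight_nonneg hδ hk'.1 hw
    rw [abs_of_nonneg (h0 w hw), ← sum_paWeight hδ hk'.1 (hv.mem_Icc hk'.2 ω)]
    exact Finset.single_le_sum h0 hw
  have hind : ∀ w ∈ Finset.Icc 1 (k - 1), Integrable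
      (fun ω => gw w ω * {ω | v k ω = w}.indicator (fun _ => (1 : ℝ)) ω) P := fun w hw => by
    refine Integrable.of_bound (C := B * C) (((hgw_meas w).mono hm le_rfl).mul
      (measurable_const.indicator (hv.measurable k hk (measurableSet_singleton w)))
        ).aestronglyMeasurable (ae_of_all _ fun ω => ?_)
    rw [Real.norm_eq_abs, abs_mul, Set.indicator_apply]
    have := hgw_bound w hw ω
    split_ifs
    · simpa using this
    · simpa using (abs_nonneg _).trans this
  have hint : ∀ w ∈ Finset.Icc 1 (k - 1), Integrable (fun ω => gw w ω * q w ω) P :=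
    fun w hw => by
    refine Integrable.of_bound (C := B * C) (((hgw_meas w).mono hm le_rfl).mul
      ((hq_meas w).mono hm le_rfl)).aestronglyMeasurable (ae_of_all _ fun ω => ?_)
    rw [Real.norm_eq_abs, abs_mul]
    exact (mul_le_of_le_one_right (abs_nonneg _) (hq_bound w hw ω)).trans (hgw_bound w hw ω)
  have hdecomp : ∀ ω, g ω * paIncrement δ₂ h (fun j => v j ω) k =
      ∑ w ∈ Finset.Icc 1 (k - 1), (gw w ω * {ω | v k ω = w}.indicator (fun _ => (1 : ℝ)) ω -
        gw w ω * q w ω) := fun ω => by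
    have h1 : ∑ w ∈ Finset.Icc 1 (k - 1),
        gw w ω * {ω | v k ω = w}.indicator (fun _ => (1 : ℝ)) ω = gw (v k ω) ω := by
      rw [Finset.sum_eq_single (v k ω)]
      · simp
      · intro w _ hw
        rw [Set.indicator_of_notMem (fun h => hw h.symm), mul_zero]
      · exact fun hn => absurd (hv.mem_vertices k hk ω) hn
    rw [Finset.sum_sub_distrib, h1, paIncrement, mul_sub, paMean, Finset.mul_sum]
    refine congrArg₂ _ rfl (Finset.sum_congr rfl fun w _ => ?_)
    simp only [hgw, hq]; ring
  simp_rw [hdecomp]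
  rw [integral_finsetSum (Finset.Icc 1 (k - 1)) fun w hw => by exact (hind w hw).sub (hint w hw)]
  refine Finset.sum_eq_zero fun w hw => ?_
  rw [integral_sub (hind w hw) (hint w hw),
    hv.integral_mul_indicator hk hw (hgw_meas w) (hgw_bound w hw), hpar, sub_self]

theorem integrable_exp_sum_paIncrement (hv : IsPAChangepoint P n tstar δ₁ δ₂ v) {A m : ℕ}
    {δ : ℝ} (hδ : -1 < δ) {h : ℕ → ℝ} {C : ℝ} (hC : ∀ d, 1 ≤ d → |h d| ≤ C) (hA : 2 ≤ A)
    (hm : m ≤ n) {θ : ℝ} (hθ : 0 ≤ θ) :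
    Integrable (fun ω => Real.exp (θ * ∑ k ∈ Finset.Ioc A m,
      paIncrement δ h (fun j => v j ω) k)) P := by
  refine Integrable.of_bound (C := Real.exp (θ * ((m - A : ℕ) * (2 * C))))
    (((measurable_sum_paIncrement δ h hA).mono (hv.paHistory_le hm) le_rfl).const_mul
      θ).exp.aestronglyMeasurable (ae_of_all _ fun ω => ?_)
  rw [Real.norm_eq_abs, Real.abs_exp, Real.exp_le_exp]
  exact mul_le_mul_of_nonneg_left
    ((le_abs_self _).trans (hv.abs_sum_paIncrement_le hδ hC hA hm ω)) hθ

/-- The exponential moment of the martingale, by induction on the number of steps. -/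
theorem integral_exp_sum_paIncrement_le (hv : IsPAChangepoint P n tstar δ₁ δ₂ v) {A m : ℕ}
    (hδ : -1 < δ₂) {h : ℕ → ℝ} {C : ℝ} (hC : ∀ d, 1 ≤ d → |h d| ≤ C) (hA : 2 ≤ A) (hAm : A ≤ m)
    (hm : m ≤ n) (hpar : ∀ k, A < k → paParam n tstar δ₁ δ₂ k = δ₂) {θ : ℝ} (hθ : 0 ≤ θ)
    (hθC : θ * (2 * C) ≤ 1) :
    ∫ ω, Real.exp (θ * ∑ k ∈ Finset.Ioc A m, paIncrement δ₂ h (fun j => v j ω) k) ∂P ≤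
      Real.exp ((θ * (2 * C)) ^ 2 * (m - A : ℕ)) := by
  induction m, hAm using Nat.le_induction with
  | base => simp
  | succ m hAm ih =>
    set S : Ω → ℝ := fun ω => ∑ k ∈ Finset.Ioc A m, paIncrement δ₂ h (fun j => v j ω) k with hS
    set d : Ω → ℝ := fun ω => paIncrement δ₂ h (fun j => v j ω) (m + 1) with hd
    have hmem : m + 1 ∈ Finset.Icc 3 n := Finset.mem_Icc.2 ⟨by omega, hm⟩
    have hsum : ∀ ω, ∑ k ∈ Finset.Ioc A (m + 1), paIncrement δ₂ h (fun j => v j ω) k =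
        S ω + d ω := fun ω => Finset.sum_Ioc_succ_top hAm _
    have hdb : ∀ ω, |θ * d ω| ≤ θ * (2 * C) := fun ω => by
      rw [abs_mul, abs_of_nonneg hθ]
      exact mul_le_mul_of_nonneg_left
        (abs_paIncrement_le hδ (by omega) (hv.mem_Icc hm ω) hC) hθ
    have hpt : ∀ ω, Real.exp (θ * (S ω + d ω)) ≤
        Real.exp (θ * S ω) * (1 + (θ * (2 * C)) ^ 2) + θ * (Real.exp (θ * S ω) * d ω) :=
      fun ω => by
      have h1 := (abs_le.1 (Real.abs_exp_sub_one_sub_id_le ((hdb ω).trans hθC))).2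
      have h2 : (θ * d ω) ^ 2 ≤ (θ * (2 * C)) ^ 2 := sq_le_sq' (abs_le.1 (hdb ω)).1
        (abs_le.1 (hdb ω)).2
      rw [mul_add, Real.exp_add]
      calc _ ≤ Real.exp (θ * S ω) * (1 + (θ * (2 * C)) ^ 2 + θ * d ω) := by
            gcongr; linarith
        _ = _ := by ring
    have hSint := hv.integrable_exp_sum_paIncrement hδ hC hA (m := m) (by omega) hθ
    have hSbound : ∀ ω, |Real.exp (θ * S ω)| ≤ Real.exp (θ * ((m - A : ℕ) * (2 * C))) :=
      fun ω => by
      rw [Real.abs_exp, Real.exp_le_exp]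
      exact mul_le_mul_of_nonneg_left
        ((le_abs_self _).trans (hv.abs_sum_paIncrement_le hδ hC hA (by omega) ω)) hθ
    have hSmeas : Measurable[paHistory v (m + 1 - 1)] fun ω => Real.exp (θ * S ω) :=
      Real.measurable_exp.comp
        (@Measurable.const_mul _ _ _ _ (paHistory v m) S _
          (measurable_sum_paIncrement δ₂ h hA) θ)
    have hzero : ∫ ω, Real.exp (θ * S ω) * d ω ∂P = 0 :=
      hv.integral_mul_paIncrement hmem (hpar _ (by omega)) hδ hC hSmeas hSbound
    have hdmeas : Measurable d :=
      (measurable_paHistory_of_congr (f := fun u => paIncrement δ₂ h u (m + 1))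
        fun u u' huu => paIncrement_congr (by omega) huu).mono (hv.paHistory_le hm) le_rfl
    have hSd : Integrable (fun ω => Real.exp (θ * S ω) * d ω) P :=
      hSint.mul_bdd (c := 2 * C) hdmeas.aestronglyMeasurable (ae_of_all _ fun ω =>
        abs_paIncrement_le hδ (by omega) (hv.mem_Icc hm ω) hC)
    simp_rw [hsum]
    calc ∫ ω, Real.exp (θ * (S ω + d ω)) ∂P
        ≤ ∫ ω, (Real.exp (θ * S ω) * (1 + (θ * (2 * C)) ^ 2) +
            θ * (Real.exp (θ * S ω) * d ω)) ∂P := by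
          refine integral_mono ?_ ((hSint.mul_const _).add (hSd.const_mul _)) hpt
          simpa only [hsum] using hv.integrable_exp_sum_paIncrement hδ hC hA hm hθ
      _ = (∫ ω, Real.exp (θ * S ω) ∂P) * (1 + (θ * (2 * C)) ^ 2) := by
          rw [integral_add (hSint.mul_const _) (hSd.const_mul _), integral_mul_const,
            integral_const_mul, hzero, mul_zero, add_zero]
      _ ≤ Real.exp ((θ * (2 * C)) ^ 2 * (m - A : ℕ)) * Real.exp ((θ * (2 * C)) ^ 2) := by
          refine mul_le_mul (ih (by omega)) ?_ (by positivity) (Real.exp_pos _).le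
          rw [add_comm]; exact Real.add_one_le_exp _
      _ = Real.exp ((θ * (2 * C)) ^ 2 * (m + 1 - A : ℕ)) := by
          rw [← Real.exp_add, Nat.sub_add_comm hAm]
          push_cast; ring_nf

/-- Union bound for the running maximum of the martingale; `θ` is the parameter of the exponential
Markov inequality. -/
theorem measure_exists_le_sum_paIncrement_le (hv : IsPAChangepoint P n tstar δ₁ δ₂ v) {A : ℕ}
    (hδ : -1 < δ₂) {h : ℕ → ℝ} {C : ℝ} (hC : ∀ d, 1 ≤ d → |h d| ≤ C) (hA : 2 ≤ A)
    (hpar : ∀ k, A < k → paParam n tstar δ₁ δ₂ k = δ₂) {θ η : ℝ} (hθ : 0 ≤ θ)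
    (hθC : θ * (2 * C) ≤ 1) (hη : 2 * θ * (2 * C) ^ 2 ≤ η) :
    P {ω | ∃ m ∈ Finset.Ioc A n,
      η * n ≤ ∑ k ∈ Finset.Ioc A m, paIncrement δ₂ h (fun j => v j ω) k} ≤
      ENNReal.ofReal (n * Real.exp (-(θ * η / 2) * n)) := by
  have hone : ∀ m ∈ Finset.Ioc A n,
      P {ω | η * n ≤ ∑ k ∈ Finset.Ioc A m, paIncrement δ₂ h (fun j => v j ω) k} ≤
        ENNReal.ofReal (Real.exp (-(θ * η / 2) * n)) := by
    intro m hm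
    rw [Finset.mem_Ioc] at hm
    rw [← ofReal_measureReal]
    refine ENNReal.ofReal_le_ofReal ((ProbabilityTheory.measure_ge_le_exp_mul_mgf (η * n) hθ
      (hv.integrable_exp_sum_paIncrement hδ hC hA hm.2 hθ)).trans ?_)
    refine (mul_le_mul_of_nonneg_left (hv.integral_exp_sum_paIncrement_le hδ hC hA hm.1.le hm.2
      hpar hθ hθC) (Real.exp_pos _).le).trans ?_
    rw [← Real.exp_add, Real.exp_le_exp]
    have h1 : ((m - A : ℕ) : ℝ) ≤ n := by exact_mod_cast (by omega : m - A ≤ n)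
    have h2 : (θ * (2 * C)) ^ 2 * ((m - A : ℕ) : ℝ) ≤ (θ * η / 2) * n := by
      refine mul_le_mul ?_ h1 (Nat.cast_nonneg _) ?_
      · nlinarith [mul_le_mul_of_nonneg_left hη hθ]
      · have : 0 ≤ η := le_trans (by positivity) hη
        positivity
    linarith
  have hset : {ω | ∃ m ∈ Finset.Ioc A n,
      η * n ≤ ∑ k ∈ Finset.Ioc A m, paIncrement δ₂ h (fun j => v j ω) k} =
      ⋃ m ∈ Finset.Ioc A n,
        {ω | η * n ≤ ∑ k ∈ Finset.Ioc A m, paIncrement δ₂ h (fun j => v j ω) k} := by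
    ext ω; simp
  rw [hset]
  refine (measure_biUnion_finset_le _ _).trans ((Finset.sum_le_card_nsmul _ _ _ hone).trans ?_)
  rw [Nat.card_Ioc, nsmul_eq_mul, ENNReal.ofReal_mul (Nat.cast_nonneg _), ENNReal.ofReal_natCast]
  gcongr
  omega

end IsPAChangepoint

end Probability

/-- On the linear scale, the martingale stays below any positive level with probability tending
to `1`. -/
theorem tendsto_measure_exists_le_sum_paIncrement {tstar δ₁ δ₂ : ℝ} (hδ : -1 < δ₂)
    {Ω : ℕ → Type*} [∀ n, MeasurableSpace (Ω n)]
    (P : ∀ n, Measure (Ω n)) [∀ n, IsProbabilityMeasure (P n)] (v : ∀ n, ℕ → Ω n → ℕ)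
    (hv : ∀ n, IsPAChangepoint (P n) n tstar δ₁ δ₂ (v n)) {A : ℕ → ℕ} (hA : ∀ n, 2 ≤ A n)
    (hpar : ∀ n k, A n < k → paParam n tstar δ₁ δ₂ k = δ₂) {h : ℕ → ℝ} {C : ℝ}
    (hC : ∀ d, 1 ≤ d → |h d| ≤ C) {η : ℝ} (hη : 0 < η) :
    Tendsto (fun n => P n {ω | ∃ m ∈ Finset.Ioc (A n) n,
      η * n ≤ ∑ k ∈ Finset.Ioc (A n) m, paIncrement δ₂ h (fun j => v n j ω) k}) atTop (𝓝 0) := by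
  have hC0 : 0 ≤ C := (abs_nonneg _).trans (hC 1 le_rfl)
  obtain ⟨θ, hθ, hθC, hθη⟩ : ∃ θ : ℝ, 0 < θ ∧ θ * (2 * C) ≤ 1 ∧ 2 * θ * (2 * C) ^ 2 ≤ η := by
    refine ⟨min (1 / (2 * C + 1)) (η / (2 * (2 * C + 1) ^ 2)), by positivity, ?_, ?_⟩
    · calc _ ≤ 1 / (2 * C + 1) * (2 * C + 1) := by gcongr; exacts [min_le_left _ _, by linarith]
        _ = 1 := by field_simp
    · calc _ ≤ 2 * (η / (2 * (2 * C + 1) ^ 2)) * (2 * C + 1) ^ 2 := by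
            gcongr; exacts [min_le_right _ _, by linarith]
        _ = η := by field_simp
  have hlim : Tendsto (fun n : ℕ => ENNReal.ofReal (n * Real.exp (-(θ * η / 2) * n))) atTop
      (𝓝 0) := by
    rw [← ENNReal.ofReal_zero]
    refine ENNReal.tendsto_ofReal ?_
    have h1 := (tendsto_rpow_mul_exp_neg_mul_atTop_nhds_zero 1 (θ * η / 2) (by positivity)).comp
      (tendsto_natCast_atTop_atTop (R := ℝ))
    simpa [Function.comp_def] using h1
  exact tendsto_of_tendsto_of_tendsto_of_le_of_le tendsto_const_nhds hlim
    (fun n => zero_le) fun n => (hv n).measure_exists_le_sum_paIncrement_le hδ hC (hA n) (hpar n)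
      hθ.le hθC hθη

/-! ### The sign of the score when the fluctuations are small -/

theorem paScore_eq_sum (v : ℕ → ℕ) (a b : ℕ) (x : ℝ) :
    paScore v a b x = ∑ k ∈ Finset.Ioc (max a 2) b,
      (1 / ((paDegree v (v k) (k - 1) : ℝ) + x) - 1 / (2 + x)) := by
  have h : (Finset.Ioc a b).filter (3 ≤ ·) = Finset.Ioc (max a 2) b := by
    ext k; simp only [Finset.mem_filter, Finset.mem_Ioc]; omega
  rw [paScore, h]

section Deterministic

variable {δ : ℝ} {v : ℕ → ℕ} {A m n : ℕ}

theorem paLeaves_ge_sub_sum (hA : 2 ≤ A) (hAm : A ≤ m)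
    (hv : ∀ j ∈ Finset.Icc 3 m, v j ∈ Finset.Icc 1 (j - 1)) :
    (m : ℝ) - A - ∑ k ∈ Finset.Ioc A m, (if paDegree v (v k) (k - 1) = 1 then 1 else 0 : ℝ) ≤
      paLeaves v m := by
  induction m, hAm using Nat.le_induction with
  | base => simp
  | succ m hAm ih =>
    have h1 := ih fun j hj => hv j (Finset.Icc_subset_Icc_right (by omega) hj)
    have h2 := paLeaves_succ_ge (hA.trans hAm) hv
    have h3 : (paLeaves v m : ℝ) + 1 ≤
        paLeaves v (m + 1) + if paDegree v (v (m + 1)) m = 1 then 1 else 0 := by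
      exact_mod_cast h2
    rw [Finset.sum_Ioc_succ_top hAm, Nat.add_sub_cancel]
    push_cast
    linarith

/-- Every step turns an old leaf into a non-leaf with probability at most `(1 + δ) / (2 + δ)`, so
the number of leaves grows at rate at least `1 / (2 + δ)`. -/
theorem paLeaves_ge (hδ : -1 < δ) (hA : 2 ≤ A) (hAm : A ≤ m) (hm : m ≤ n)
    (hv : ∀ j ∈ Finset.Icc 3 n, v j ∈ Finset.Icc 1 (j - 1)) {η : ℝ} (hη : 0 ≤ η)
    (hnoise : ∀ m ∈ Finset.Ioc A n, ∑ k ∈ Finset.Ioc A m,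
      paIncrement δ (fun d => if d = 1 then 1 else 0) v k < η * n) :
    ((m : ℝ) - A) / (2 + δ) - η * n ≤ paLeaves v m := by
  have h1 := paLeaves_ge_sub_sum hA hAm
    fun j hj => hv j (Finset.Icc_subset_Icc_right (by omega) hj)
  have h2 : ∑ k ∈ Finset.Ioc A m, paIncrement δ (fun d => if d = 1 then 1 else 0) v k ≤
      η * n := by
    rcases hAm.eq_or_lt with rfl | h
    · simpa using mul_nonneg hη (Nat.cast_nonneg n)
    · exact (hnoise m (Finset.mem_Ioc.2 ⟨h, hm⟩)).le
  have h3 : ∑ k ∈ Finset.Ioc A m, paMean δ (fun d => if d = 1 then 1 else 0) v k ≤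
      ((m : ℝ) - A) * ((1 + δ) / (2 + δ)) := by
    refine (Finset.sum_le_card_nsmul _ _ ((1 + δ) / (2 + δ)) fun k hk => ?_).trans ?_
    · rw [Finset.mem_Ioc] at hk
      exact paMean_leaf_le hδ (by omega)
    · rw [Nat.card_Ioc, nsmul_eq_mul, Nat.cast_sub hAm]
  simp only [paIncrement, Finset.sum_sub_distrib] at h2
  have h4 : ((m : ℝ) - A) / (2 + δ) = (m : ℝ) - A - ((m : ℝ) - A) * ((1 + δ) / (2 + δ)) := by
    have : 2 + δ ≠ 0 := by linarith
    field_simp; ring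
  linarith

theorem sum_Ioc_sub_one_sub (hAm : A ≤ m) :
    ∑ k ∈ Finset.Ioc A m, ((k : ℝ) - 1 - A) = ((m : ℝ) - A) * (m - A - 1) / 2 := by
  induction m, hAm using Nat.le_induction with
  | base => simp
  | succ m hAm ih =>
    rw [Finset.sum_Ioc_succ_top hAm, ih]
    push_cast; ring

/-- When the noise in the number of leaves and in the score is small on the linear scale, then
after a linear number of steps the score at `x` has the sign of `δ - x`. -/
theorem mul_paScore_pos (hδ : -1 < δ) {x : ℝ} (hx : -1 < x) {a : ℕ}
    (hv : ∀ j ∈ Finset.Icc 3 n, v j ∈ Finset.Icc 1 (j - 1)) {τ K : ℝ} (hτ : 0 < τ)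
    (hK : K = (δ - x) ^ 2 / ((1 + x) * (2 + x) ^ 2 * (2 + δ))) (hK0 : 0 < K)
    (hleaf : ∀ m ∈ Finset.Ioc (max a 2) n, ∑ k ∈ Finset.Ioc (max a 2) m,
      paIncrement δ (fun d => if d = 1 then 1 else 0) v k < τ / (8 * (2 + δ)) * n)
    (hnoise : ∀ m ∈ Finset.Ioc (max a 2) n, ∑ k ∈ Finset.Ioc (max a 2) m,
      paIncrement δ (fun d => -((δ - x) * (1 / ((d : ℝ) + x) - 1 / (2 + x)))) v k <
        K * τ ^ 2 / (16 * (2 + δ)) * n)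
    (hn : 0 < n) (hm : m ≤ n) (ham : n * τ / 2 ≤ (m : ℝ) - (max a 2 : ℕ) - 1) :
    0 < (δ - x) * paScore v a m x := by
  set A := max a 2 with hAdef
  have hA : 2 ≤ A := le_max_right _ _
  have hn' : (0 : ℝ) < n := by exact_mod_cast hn
  have h4 : 0 < 2 + δ := by linarith
  have hnτ : 0 < n * τ / 2 := by positivity
  have hAm : A < m := by
    have : (A : ℝ) < m := by linarith
    exact_mod_cast this
  set c := 1 / (2 + δ) with hc
  have hc0 : 0 < c := by positivity
  have hη : τ / (8 * (2 + δ)) = c * τ / 8 := by rw [hc]; field_simp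
  have hη' : K * τ ^ 2 / (16 * (2 + δ)) = K * (c * τ ^ 2 / 16) := by rw [hc]; field_simp
  rw [hη] at hleaf
  rw [hη'] at hnoise
  have hterm : ∀ k ∈ Finset.Ioc A m, K / n * (c * ((k : ℝ) - 1 - A) - c * τ / 8 * n) ≤
      paMean δ (fun d => (δ - x) * (1 / ((d : ℝ) + x) - 1 / (2 + x))) v k := fun k hk => by
    rw [Finset.mem_Ioc] at hk
    have hvk : ∀ j ∈ Finset.Icc 3 k, v j ∈ Finset.Icc 1 (j - 1) :=
      fun j hj => hv j (Finset.Icc_subset_Icc_right (by omega) hj)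
    have h1 := paMean_score_ge hδ hx (by omega) hvk
    rw [← hK] at h1
    have h2 := paLeaves_ge hδ hA (m := k - 1) (by omega) (by omega) hv (by positivity) hleaf
    rw [Nat.cast_sub (by omega), Nat.cast_one] at h2
    have h5 : (k : ℝ) - 1 ≤ n := by
      have : (k : ℝ) ≤ n := by exact_mod_cast hk.2.trans hm
      linarith
    have h6 : (0 : ℝ) < (k : ℝ) - 1 := by
      have : (3 : ℝ) ≤ k := by exact_mod_cast (by omega : 3 ≤ k)
      linarith
    refine le_trans ?_ h1
    calc K / n * (c * ((k : ℝ) - 1 - A) - c * τ / 8 * n) ≤ K / n * paLeaves v (k - 1) := by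
          gcongr
          rw [hc]; rw [hc] at h2
          calc _ = ((k : ℝ) - 1 - A) / (2 + δ) - 1 / (2 + δ) * τ / 8 * n := by ring
            _ ≤ _ := h2
      _ = K * (paLeaves v (k - 1) / n) := by ring
      _ ≤ K * (paLeaves v (k - 1) / ((k : ℝ) - 1)) := by gcongr
  have hsum := Finset.sum_le_sum hterm
  rw [← Finset.mul_sum, Finset.sum_sub_distrib, ← Finset.mul_sum, sum_Ioc_sub_one_sub hAm.le,
    Finset.sum_const, Nat.card_Ioc, nsmul_eq_mul, Nat.cast_sub hAm.le] at hsum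
  have hN := hnoise m (Finset.mem_Ioc.2 ⟨hAm, hm⟩)
  simp only [paIncrement, paMean_neg, Finset.sum_sub_distrib, Finset.sum_neg_distrib] at hN
  rw [paScore_eq_sum, Finset.mul_sum]
  -- There are at least `n τ / 2` terms, and their average is at least `K / n * (c * τ / 8 * n)`.
  have hdrift : K * (c * τ ^ 2 / 16) * n ≤
      K / n * (c * (((m : ℝ) - A) * (m - A - 1) / 2) - (m - A) * (c * τ / 8 * n)) := by
    have hr : n * τ / 2 ≤ (m : ℝ) - A := by linarith
    calc K * (c * τ ^ 2 / 16) * n = K / n * ((n * τ / 2) * (c * (τ / 8) * n)) := by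
          field_simp; ring
      _ ≤ K / n * (((m : ℝ) - A) * (c * ((m : ℝ) - A - 1) / 2 - c * τ / 8 * n)) := by
          have : c * (τ / 8) * n ≤ c * ((m : ℝ) - A - 1) / 2 - c * τ / 8 * n := by
            have := mul_le_mul_of_nonneg_left ham hc0.le
            linarith
          have h0 : 0 ≤ c * (τ / 8) * n := by positivity
          have h00 : 0 ≤ (m : ℝ) - A := by linarith
          gcongr
      _ = _ := by ring
  linarith

/-! ### Roots of the score equation -/

/-- Two distinct roots would make every chosen degree at most `2`, since
`(1 + x) (2 + x) u(x) = ∑ (2 - D) (1 + x) / (D + x)` is a sum of antitone functions, strictly so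
for `D ≥ 3`; but then the score is nowhere negative. -/
theorem paScore_root_unique {a b : ℕ} (hv : ∀ j ∈ Finset.Icc 3 b, v j ∈ Finset.Icc 1 (j - 1))
    {x y z : ℝ} (hx : -1 < x) (hy : -1 < y) (hz : -1 < z) (hx0 : paScore v a b x = 0)
    (hy0 : paScore v a b y = 0) (hzneg : paScore v a b z < 0) : x = y := by
  by_contra hne
  rw [paScore_eq_sum] at hx0 hy0 hzneg
  have hdeg : ∀ k ∈ Finset.Ioc (max a 2) b, (1 : ℝ) ≤ paDegree v (v k) (k - 1) := fun k hk => by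
    rw [Finset.mem_Ioc] at hk
    exact_mod_cast paDegree_pos v (hv k (Finset.mem_Icc.2 ⟨by omega, hk.2⟩))
  have hpos : ∀ k ∈ Finset.Ioc (max a 2) b, 0 ≤ ((paDegree v (v k) (k - 1) : ℝ) - 1) *
      ((paDegree v (v k) (k - 1) : ℝ) - 2) /
        (((paDegree v (v k) (k - 1) : ℝ) + x) * ((paDegree v (v k) (k - 1) : ℝ) + y)) :=
    fun k hk => by
    have h1 := hdeg k hk
    generalize paDegree v (v k) (k - 1) = d at h1 ⊢
    refine div_nonneg ?_ (mul_nonneg (by linarith) (by linarith))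
    rcases (Nat.one_le_cast.1 h1).eq_or_lt with rfl | h
    · simp
    · have : (2 : ℝ) ≤ d := by exact_mod_cast h
      exact mul_nonneg (by linarith) (by linarith)
  have hsum : ∑ k ∈ Finset.Ioc (max a 2) b, ((paDegree v (v k) (k - 1) : ℝ) - 1) *
      ((paDegree v (v k) (k - 1) : ℝ) - 2) /
        (((paDegree v (v k) (k - 1) : ℝ) + x) * ((paDegree v (v k) (k - 1) : ℝ) + y)) = 0 := by
    have h1 : (x - y) * ∑ k ∈ Finset.Ioc (max a 2) b, ((paDegree v (v k) (k - 1) : ℝ) - 1) *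
      ((paDegree v (v k) (k - 1) : ℝ) - 2) /
        (((paDegree v (v k) (k - 1) : ℝ) + x) * ((paDegree v (v k) (k - 1) : ℝ) + y)) =
        (1 + y) * (2 + y) * ∑ k ∈ Finset.Ioc (max a 2) b,
          (1 / ((paDegree v (v k) (k - 1) : ℝ) + y) - 1 / (2 + y)) -
        (1 + x) * (2 + x) * ∑ k ∈ Finset.Ioc (max a 2) b,
          (1 / ((paDegree v (v k) (k - 1) : ℝ) + x) - 1 / (2 + x)) := by
      simp only [Finset.mul_sum]
      rw [← Finset.sum_sub_distrib]
      refine Finset.sum_congr rfl fun k hk => ?_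
      have h1 := hdeg k hk
      have h2 : (paDegree v (v k) (k - 1) : ℝ) + x ≠ 0 := by linarith
      have h3 : (paDegree v (v k) (k - 1) : ℝ) + y ≠ 0 := by linarith
      have h4 : 2 + x ≠ 0 := by linarith
      have h5 : 2 + y ≠ 0 := by linarith
      field_simp; ring
    rw [hx0, hy0, mul_zero, mul_zero, sub_zero] at h1
    exact (mul_eq_zero.1 h1).resolve_left (sub_ne_zero.2 hne)
  refine hzneg.not_ge (Finset.sum_nonneg fun k hk => ?_)
  have h0 := (Finset.sum_eq_zero_iff_of_nonneg hpos).1 hsum k hk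
  have h1 := hdeg k hk
  have h2 : (paDegree v (v k) (k - 1) : ℝ) ≤ 2 := by
    have h3 : ((paDegree v (v k) (k - 1) : ℝ) + x) * ((paDegree v (v k) (k - 1) : ℝ) + y) ≠ 0 :=
      (mul_pos (by linarith) (by linarith)).ne'
    rcases mul_eq_zero.1 ((div_eq_zero_iff.1 h0).resolve_right h3) with h | h <;> linarith
  exact sub_nonneg.2 (one_div_le_one_div_of_le (by linarith) (by linarith))

/-- The intermediate value theorem yields a root of the score between two points where it has
opposite signs. -/
theorem exists_paScore_eq_zero {a b : ℕ} (hv : ∀ j ∈ Finset.Icc 3 b, v j ∈ Finset.Icc 1 (j - 1))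
    {y z : ℝ} (hy : -1 < y) (hyz : y ≤ z) (hypos : 0 < paScore v a b y)
    (hzneg : paScore v a b z < 0) : ∃ x ∈ Icc y z, paScore v a b x = 0 := by
  have hcont : ContinuousOn (paScore v a b) (Icc y z) := by
    have : paScore v a b = fun x => ∑ k ∈ Finset.Ioc (max a 2) b,
        (1 / ((paDegree v (v k) (k - 1) : ℝ) + x) - 1 / (2 + x)) :=
      funext fun x => paScore_eq_sum v a b x
    rw [this]
    refine continuousOn_finsetSum _ fun k hk => ?_
    rw [Finset.mem_Ioc] at hk
    have h1 : (1 : ℝ) ≤ paDegree v (v k) (k - 1) := by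
      exact_mod_cast paDegree_pos v (hv k (Finset.mem_Icc.2 ⟨by omega, hk.2⟩))
    refine ContinuousOn.sub ?_ ?_ <;>
      refine continuousOn_const.div (by fun_prop) fun x hx => ?_ <;>
      linarith [hx.1]
  exact intermediate_value_Icc' hyz hcont ⟨hzneg.le, hypos.le⟩

/-- If the score changes its sign between the points `δ ± ε` of `Θ`, then it has exactly one root
in `Θ`, and the estimator is within `ε` of `δ`. -/
theorem existsUnique_root_and_abs_paMLE_sub_le {Θ : Set ℝ} (hΘ : Θ ⊆ Ioi (-1)) {ε : ℝ}
    (hε : 0 ≤ ε) (hsub : Icc (δ - ε) (δ + ε) ⊆ Θ) {a b : ℕ}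
    (hv : ∀ j ∈ Finset.Icc 3 b, v j ∈ Finset.Icc 1 (j - 1))
    (hpos : 0 < paScore v a b (δ - ε)) (hneg : paScore v a b (δ + ε) < 0) :
    (∃! x, x ∈ Θ ∧ paScore v a b x = 0) ∧ |paMLE Θ v a b - δ| ≤ ε := by
  obtain ⟨x, hx, hx0⟩ := exists_paScore_eq_zero hv (hΘ (hsub ⟨le_rfl, by linarith⟩))
    (by linarith) hpos hneg
  have huniq : ∀ y, y ∈ Θ ∧ paScore v a b y = 0 → y = x := fun y hy =>
    paScore_root_unique hv (hΘ hy.1) (hΘ (hsub hx)) (hΘ (hsub ⟨by linarith, le_rfl⟩)) hy.2 hx0 hneg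
  refine ⟨⟨x, ⟨hsub hx, hx0⟩, huniq⟩, ?_⟩
  have hex : ∃ x ∈ Θ, paScore v a b x = 0 := ⟨x, hsub hx, hx0⟩
  rw [paMLE, dif_pos hex, huniq _ hex.choose_spec, abs_le]
  exact ⟨by linarith [hx.1], by linarith [hx.2]⟩

end Deterministic

/-! ### Consistency -/

section Consistency

variable {tstar s τ δ₁ δ₂ : ℝ} {Ω : ℕ → Type*} [∀ n, MeasurableSpace (Ω n)]
  (P : ∀ n, Measure (Ω n)) [∀ n, IsProbabilityMeasure (P n)] (v : ∀ n, ℕ → Ω n → ℕ)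

/-- At a fixed `x ≠ δ₂`, the probability that the score has the wrong sign at some
`t ∈ [s + τ, 1]` tends to `0`. -/
theorem tendsto_measure_exists_mul_paScore_nonpos (hs : s ∈ Icc tstar 1) (htstar : 0 ≤ tstar)
    (hτ : 0 < τ) (hδ : -1 < δ₂) (hv : ∀ n, IsPAChangepoint (P n) n tstar δ₁ δ₂ (v n)) {x : ℝ}
    (hx : -1 < x) (hxδ : x ≠ δ₂) :
    Tendsto (fun n : ℕ => P n {ω | ∃ t ∈ Icc (s + τ) 1, (δ₂ - x) *
      paScore (fun k => v n k ω) ⌊(n : ℝ) * s⌋₊ ⌊(n : ℝ) * t⌋₊ x ≤ 0}) atTop (𝓝 0) := by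
  have h4 : 0 < 2 + δ₂ := by linarith
  have h6 : 0 < 2 + x := by linarith
  have h7 : 0 < 1 + x := by linarith
  set K := (δ₂ - x) ^ 2 / ((1 + x) * (2 + x) ^ 2 * (2 + δ₂)) with hK
  have hK0 : 0 < K := by
    have : 0 < (δ₂ - x) ^ 2 := by have := sub_ne_zero.2 hxδ.symm; positivity
    positivity
  have hpar : ∀ n k : ℕ, max ⌊(n : ℝ) * s⌋₊ 2 < k → paParam n tstar δ₁ δ₂ k = δ₂ :=
    fun n k hk => by
    have h1 : ⌊(n : ℝ) * tstar⌋₊ ≤ ⌊(n : ℝ) * s⌋₊ :=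
      Nat.floor_mono (mul_le_mul_of_nonneg_left hs.1 (Nat.cast_nonneg n))
    rw [paParam, if_neg (by omega)]
  have hleaf := tendsto_measure_exists_le_sum_paIncrement hδ P v hv
    (A := fun n => max ⌊(n : ℝ) * s⌋₊ 2) (fun n => le_max_right _ _) hpar
    (h := fun d => if d = 1 then 1 else 0) (C := 1)
    (fun d _ => by split_ifs <;> simp) (η := τ / (8 * (2 + δ₂))) (by positivity)
  have hnoise := tendsto_measure_exists_le_sum_paIncrement hδ P v hv
    (A := fun n => max ⌊(n : ℝ) * s⌋₊ 2) (fun n => le_max_right _ _) hpar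
    (h := fun d => -((δ₂ - x) * (1 / ((d : ℝ) + x) - 1 / (2 + x))))
    -- A bound for degrees `d ≥ 1`; at `d = 0` the function may be large.
    (C := |δ₂ - x| * (1 / (1 + x) + 1 / (2 + x)))
    (fun d hd => by
      have hd' : (1 : ℝ) ≤ d := by exact_mod_cast hd
      have h8 : 0 < (d : ℝ) + x := by linarith
      rw [abs_neg, abs_mul]
      refine mul_le_mul_of_nonneg_left ((abs_sub _ _).trans ?_) (abs_nonneg _)
      rw [abs_of_pos (by positivity), abs_of_pos (by positivity)]
      gcongr)
    (η := K * τ ^ 2 / (16 * (2 + δ₂))) (by positivity)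
  have hsum := hleaf.add hnoise
  rw [add_zero] at hsum
  refine tendsto_of_tendsto_of_tendsto_of_le_of_le' tendsto_const_nhds hsum
    (Eventually.of_forall fun n => zero_le) ?_
  filter_upwards [eventually_gt_atTop 0, eventually_ge_atTop ⌈8 / τ⌉₊] with n hn0 hn
  refine (measure_mono fun ω hω => ?_).trans (measure_union_le _ _)
  obtain ⟨t, ht, hle⟩ := hω
  by_contra hcon
  simp only [Set.mem_union, Set.mem_ofPred_eq, not_or, not_exists, not_and, not_le] at hcon
  have hn8 : 8 ≤ n * τ := (div_le_iff₀ hτ).1 ((Nat.le_ceil _).trans (by exact_mod_cast hn))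
  have hs0 : 0 ≤ s := htstar.trans hs.1
  have hmn : ⌊(n : ℝ) * t⌋₊ ≤ n := by
    refine Nat.floor_le_of_le ?_
    simpa using mul_le_mul_of_nonneg_left ht.2 (Nat.cast_nonneg (α := ℝ) n)
  refine hle.not_gt (mul_paScore_pos hδ hx ((hv n).mem_Icc le_rfl ω) hτ hK hK0 hcon.1 hcon.2 hn0
    hmn ?_)
  have h1 := Nat.lt_floor_add_one ((n : ℝ) * t)
  have h2 : (n : ℝ) * (s + τ) ≤ n * t := mul_le_mul_of_nonneg_left ht.1 (Nat.cast_nonneg n)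
  have h3 : ((max ⌊(n : ℝ) * s⌋₊ 2 : ℕ) : ℝ) ≤ n * s + 2 := by
    have h30 : (0 : ℝ) ≤ n * s := by positivity
    have h31 := Nat.floor_le h30
    rw [Nat.cast_max, Nat.cast_ofNat]
    exact max_le (by linarith) (by linarith)
  linarith

end Consistency

theorem mainTheorem2 (tstar s τ δ₁ δ₂ : ℝ) (htstar : tstar ∈ Icc (0 : ℝ) 1)
    (hs : s ∈ Icc tstar 1) (hτ : τ ∈ Ioo 0 (1 - s)) (hδ₁ : -1 < δ₁)
    (Θ : Set ℝ) (hΘ : Θ ⊆ Ioi (-1)) (hδ₂ : Θ ∈ 𝓝 δ₂)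
    {Ω : ℕ → Type*} [∀ n, MeasurableSpace (Ω n)]
    (P : ∀ n, Measure (Ω n)) [∀ n, IsProbabilityMeasure (P n)]
    (v : ∀ n, ℕ → Ω n → ℕ)
    (hv : ∀ n, IsPAChangepoint (P n) n tstar δ₁ δ₂ (v n)) :
    Tendsto (fun n : ℕ => P n {ω | ∀ t ∈ Icc (s + τ) 1, ∃! x, x ∈ Θ ∧
        paScore (fun k => v n k ω) ⌊(n : ℝ) * s⌋₊ ⌊(n : ℝ) * t⌋₊ x = 0}) atTop (𝓝 1) ∧
    ∀ ε : ℝ, 0 < ε →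
      Tendsto (fun n : ℕ => P n {ω | ε ≤ ⨆ t : Icc (s + τ) 1,
        |paMLE Θ (fun k => v n k ω) ⌊(n : ℝ) * s⌋₊ ⌊(n : ℝ) * (t : ℝ)⌋₊ - δ₂|}) atTop (𝓝 0) := by
  have hδ : -1 < δ₂ := hΘ (mem_of_mem_nhds hδ₂)
  obtain ⟨r, hr, hball⟩ := Metric.nhds_basis_closedBall.mem_iff.1 hδ₂
  rw [Real.closedBall_eq_Icc] at hball
  have hbad : ∀ ε : ℝ, 0 < ε → ε ≤ r →
      Tendsto (fun n : ℕ => P n {ω | ∃ t ∈ Icc (s + τ) 1,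
        ¬ ((∃! x, x ∈ Θ ∧ paScore (fun k => v n k ω) ⌊(n : ℝ) * s⌋₊ ⌊(n : ℝ) * t⌋₊ x = 0) ∧
          |paMLE Θ (fun k => v n k ω) ⌊(n : ℝ) * s⌋₊ ⌊(n : ℝ) * t⌋₊ - δ₂| ≤ ε)})
        atTop (𝓝 0) := by
    intro ε hε hεr
    have hsub : Icc (δ₂ - ε) (δ₂ + ε) ⊆ Θ :=
      (Icc_subset_Icc (by linarith) (by linarith)).trans hball
    have hlow := tendsto_measure_exists_mul_paScore_nonpos P v hs htstar.1 hτ.1 hδ hv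
      (hΘ (hsub ⟨le_rfl, by linarith⟩)) (by linarith : δ₂ - ε ≠ δ₂)
    have hup := tendsto_measure_exists_mul_paScore_nonpos P v hs htstar.1 hτ.1 hδ hv
      (hΘ (hsub ⟨by linarith, le_rfl⟩)) (by linarith : δ₂ + ε ≠ δ₂)
    have hsum := hlow.add hup
    rw [add_zero] at hsum
    refine tendsto_of_tendsto_of_tendsto_of_le_of_le tendsto_const_nhds hsum
      (fun n => zero_le) fun n => ?_
    refine (measure_mono fun ω hω => ?_).trans (measure_union_le _ _)
    obtain ⟨t, ht, hfail⟩ := hω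
    by_contra hcon
    simp only [Set.mem_union, Set.mem_ofPred_eq, not_or, not_exists, not_and, not_le] at hcon
    have h1 := hcon.1 t ht
    have h2 := hcon.2 t ht
    rw [sub_sub_cancel] at h1
    rw [sub_add_cancel_left, neg_mul, neg_pos] at h2
    have hmn : ⌊(n : ℝ) * t⌋₊ ≤ n := by
      refine Nat.floor_le_of_le ?_
      simpa using mul_le_mul_of_nonneg_left ht.2 (Nat.cast_nonneg (α := ℝ) n)
    exact hfail (existsUnique_root_and_abs_paMLE_sub_le hΘ hε.le hsub ((hv n).mem_Icc hmn ω)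
      (pos_of_mul_pos_right h1 hε.le) (neg_of_mul_neg_right h2 hε.le))
  refine ⟨?_, fun ε hε => ?_⟩
  · -- The event need not be measurable, so subadditivity of the outer measure is used.
    have hlim : Tendsto (fun n : ℕ => 1 - P n {ω | ∃ t ∈ Icc (s + τ) 1,
        ¬ ((∃! x, x ∈ Θ ∧ paScore (fun k => v n k ω) ⌊(n : ℝ) * s⌋₊ ⌊(n : ℝ) * t⌋₊ x = 0) ∧
          |paMLE Θ (fun k => v n k ω) ⌊(n : ℝ) * s⌋₊ ⌊(n : ℝ) * t⌋₊ - δ₂| ≤ r)})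
        atTop (𝓝 1) := by
      simpa using ENNReal.Tendsto.sub tendsto_const_nhds (hbad r hr le_rfl)
        (Or.inl ENNReal.one_ne_top)
    refine tendsto_of_tendsto_of_tendsto_of_le_of_le hlim tendsto_const_nhds (fun n => ?_)
      fun n => prob_le_one
    rw [tsub_le_iff_right, ← measure_univ (μ := P n)]
    refine (measure_mono fun ω _ => ?_).trans (measure_union_le _ _)
    by_cases h : ω ∈ {ω | ∀ t ∈ Icc (s + τ) 1, ∃! x, x ∈ Θ ∧
        paScore (fun k => v n k ω) ⌊(n : ℝ) * s⌋₊ ⌊(n : ℝ) * t⌋₊ x = 0}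
    · exact Or.inl h
    · simp only [Set.mem_ofPred_eq, not_forall] at h
      obtain ⟨t, ht, hne⟩ := h
      exact Or.inr ⟨t, ht, fun hh => hne hh.1⟩
  · -- The supremum may equal the bound, whence `ε / 2` instead of `ε`.
    refine tendsto_of_tendsto_of_tendsto_of_le_of_le tendsto_const_nhds
      (hbad (min (ε / 2) r) (by positivity) (min_le_right _ _)) (fun n => zero_le) fun n =>
        measure_mono fun ω hω => ?_
    by_contra hcon
    have : Nonempty (Icc (s + τ) 1) := ⟨⟨1, by linarith [hτ.2], le_rfl⟩⟩
    have h1 : ⨆ t : Icc (s + τ) 1,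
        |paMLE Θ (fun k => v n k ω) ⌊(n : ℝ) * s⌋₊ ⌊(n : ℝ) * (t : ℝ)⌋₊ - δ₂| ≤ ε / 2 :=
      ciSup_le fun t => by
        by_contra h
        exact hcon ⟨t, t.2, fun hh => h (hh.2.trans (min_le_left _ _))⟩
    have h2 : ε ≤ _ := hω
    linarith
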